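/- Let $n\ge 1$ and let $\sigma=(\sigma_{ij})$ be a symmetric complex $n\times n$ matrix. On $\mathbb{C}^{4n}=\mathbb{R}^{8n}$ with complex coordinates $z^1,\dots,z^{4n}$ put $\sigma(z)=\sum_{i,j=1}^n\sigma_{ij}z^iz^{j+n}$ and $$f(z)=\sum_{a=1}^{2n}\bigl(z^a\overline{z}^{\,a+2n}+\overline{z}^{\,a}z^{a+2n}\bigr)+|\sigma(z)|^2 ,$$ and let $g=\sum_{A,B=1}^{4n} h_{AB}\,dz^A\cdot d\overline{z}^B$ with $h_{AB}=\dfrac{\partial^2 f}{\partial z^A\,\partial\overline{z}^B}$, i.e. $g_z(v,w)=\mathrm{Re}\sum_{A,B}h_{AB}(z)\,v^A\overline{w}^B$. A diffeomorphism here is a $C^\infty$ diffeomorphism of $\mathbb{R}^{8n}$ onto itself; the conformal group of $(\mathbb{R}^{8n},g)$ is the group of diffeomorphisms $\phi$ with $\phi^*g=e^{2u}g$ for some $u\in C^\infty(\mathbb{R}^{8n})$; such a $\phi$ is a homothety if $\phi^*g=e^{2\lambda}g$ with $\lambda\in\mathbb{R}$ constant, a proper homothety if moreover $\lambda\ne0$,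 and an isometry if $\phi^*g=g$. For $a,b\in\mathbb{R}$ let $\phi_{a,b}$ be the complex linear map $$\phi_{a,b}=\mathrm{diag}\bigl(e^{a}\mathbf 1_n,\;e^{b}\mathbf 1_n,\;e^{a+2b}\mathbf 1_n,\;e^{2a+b}\mathbf 1_n\bigr)$$ of $\mathbb{C}^{4n}$, and let $\phi_s:=\phi_{s,s}=\mathrm{diag}(e^s\mathbf 1_{2n},e^{3s}\mathbf 1_{2n})$ for $s\in\mathbb{R}$. 1. The conformal group of $(\mathbb{R}^{8n},g)$ is the semidirect product $\mathbb{R}\ltimes\mathrm{Iso}(\mathbb{R}^{8n},g)$, where the factor $\mathbb{R}$ is the one-parameter group $\{\phi_s\mid s\in\mathbb{R}\}$ of homotheties, $\phi_s^*g=e^{4s}g$ (proper for $s\neq0$): for a suitable action of $\mathbb{R}$ on $\mathrm{Iso}(\mathbb{R}^{8n},g)$ by automorphisms, $(\psi,s)\mapsto\psi\circ\phi_s$ is an isomorphism from the semidirect product onto the conformal group. 2. The maps $\phi_{a,b}$ form an abelian two-real-parameter group of homotheties fixing the origin: $\phi_{a,b}^*g=e^{2(a+b)}g$, $\phi_{a,b}(0)=0$,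 $\phi_{a,b}\circ\phi_{a',b'}=\phi_{a+a',b+b'}$, and $(a,b)\mapsto\phi_{a,b}$ is injective. -/

import Mathlib

open scoped ContDiff ComplexConjugate

noncomputable section

namespace ConfGroup

/-! ### Diffeomorphisms, conformal transformations, isometries

A semi-Riemannian metric on a real vector space `E` is given by its values `g x v w`,
for `x` a point and `v w` tangent vectors at `x`. -/

section General

variable {E : Type*} [NormedAddCommGroup E] [NormedSpace ℝ E]

/-- The pull-back `φ^* g`. -/
def pullback (φ : E → E) (g : E → E → E → ℝ) : E → E → E → ℝ :=
  fun x v w => g (φ x) (fderiv ℝ φ x v) (fderiv ℝ φ x w)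

/-- `φ` is a `C^∞` diffeomorphism of `E` onto itself. -/
def IsDiffeo (φ : Equiv.Perm E) : Prop :=
  ContDiff ℝ ∞ φ ∧ ContDiff ℝ ∞ φ.symm

/-- `φ` is a conformal transformation of `(E, g)`: a diffeomorphism with
`φ^* g = e^{2u} g` for some smooth function `u`. -/
def IsConformal (g : E → E → E → ℝ) (φ : Equiv.Perm E) : Prop :=
  IsDiffeo φ ∧ ∃ u : E → ℝ, ContDiff ℝ ∞ u ∧
    ∀ x v w, pullback φ g x v w = Real.exp (2 * u x) * g x v w

/-- `φ` is a homothety of `(E, g)` with `φ^* g = e^{2c} g` for the constant `c`;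
it is proper if `c ≠ 0`. -/
def IsHomothety (g : E → E → E → ℝ) (φ : Equiv.Perm E) (c : ℝ) : Prop :=
  IsDiffeo φ ∧ ∀ x v w, pullback φ g x v w = Real.exp (2 * c) * g x v w

/-- `φ` is an isometry of `(E, g)`: a diffeomorphism with `φ^* g = g`. -/
def IsIsometry (g : E → E → E → ℝ) (φ : Equiv.Perm E) : Prop :=
  IsDiffeo φ ∧ pullback φ g = g

theorem IsDiffeo.one : IsDiffeo (1 : Equiv.Perm E) := ⟨contDiff_id, contDiff_id⟩

theorem IsDiffeo.mul {φ ψ : Equiv.Perm E} (hφ : IsDiffeo φ) (hψ : IsDiffeo ψ) :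
    IsDiffeo (φ * ψ) :=
  ⟨hφ.1.comp hψ.1, hψ.2.comp hφ.2⟩

theorem IsDiffeo.inv {φ : Equiv.Perm E} (hφ : IsDiffeo φ) : IsDiffeo φ⁻¹ :=
  ⟨hφ.2, hφ.1⟩

theorem pullback_one (g : E → E → E → ℝ) : pullback (1 : Equiv.Perm E) g = g := by
  funext x v w
  have h : ((1 : Equiv.Perm E) : E → E) = id := rfl
  simp [pullback, h]

theorem pullback_mul (g : E → E → E → ℝ) {φ ψ : Equiv.Perm E} (hφ : IsDiffeo φ)
    (hψ : IsDiffeo ψ) (x v w : E) :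
    pullback (φ * ψ : Equiv.Perm E) g x v w
      = pullback φ g (ψ x) (fderiv ℝ ψ x v) (fderiv ℝ ψ x w) := by
  have h : ((φ * ψ : Equiv.Perm E) : E → E) = φ ∘ ψ := rfl
  have hd : fderiv ℝ (φ ∘ ψ) x = (fderiv ℝ φ (ψ x)).comp (fderiv ℝ ψ x) :=
    fderiv_comp x (hφ.1.differentiable (by simp) _) (hψ.1.differentiable (by simp) _)
  simp [pullback, h, hd]

/-- If `φ^* g = ρ g`, then `ρ (φ⁻¹ x) * ((φ⁻¹)^* g) x = g x`. -/
theorem pullback_inv {g : E → E → E → ℝ} {φ : Equiv.Perm E} (hφ : IsDiffeo φ) {ρ : E → ℝ}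
    (h : ∀ x v w, pullback φ g x v w = ρ x * g x v w) (x v w : E) :
    ρ (φ⁻¹ x) * pullback (φ⁻¹ : Equiv.Perm E) g x v w = g x v w := by
  have h1 := pullback_mul g hφ hφ.inv x v w
  rw [mul_inv_cancel, pullback_one, h] at h1
  exact h1.symm

/-- The conformal group of `(E, g)`. -/
def conformalGroup (g : E → E → E → ℝ) : Subgroup (Equiv.Perm E) where
  carrier := {φ | IsConformal g φ}
  one_mem' := ⟨IsDiffeo.one, fun _ => 0, contDiff_const, fun x v w => by
    rw [pullback_one]; simp⟩
  mul_mem' := by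
    rintro φ ψ ⟨hφ, u, hu, h⟩ ⟨hψ, u', hu', h'⟩
    refine ⟨hφ.mul hψ, fun x => u (ψ x) + u' x, (hu.comp hψ.1).add hu', fun x v w => ?_⟩
    have h2 := h' x v w
    simp only [pullback] at h2
    rw [pullback_mul g hφ hψ, h, h2, mul_add, Real.exp_add, mul_assoc]
  inv_mem' := by
    rintro φ ⟨hφ, u, hu, h⟩
    refine ⟨hφ.inv, fun x => -u (φ⁻¹ x), (hu.comp hφ.inv.1).neg, fun x v w => ?_⟩
    rw [← pullback_inv hφ h x v w, ← mul_assoc, ← Real.exp_add]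
    simp

/-- The isometry group of `(E, g)`. -/
def isometryGroup (g : E → E → E → ℝ) : Subgroup (Equiv.Perm E) where
  carrier := {φ | IsIsometry g φ}
  one_mem' := ⟨IsDiffeo.one, pullback_one g⟩
  mul_mem' := by
    rintro φ ψ ⟨hφ, h⟩ ⟨hψ, h'⟩
    refine ⟨hφ.mul hψ, ?_⟩
    funext x v w
    rw [pullback_mul g hφ hψ, h]
    exact congrFun (congrFun (congrFun h' x) v) w
  inv_mem' := by
    rintro φ ⟨hφ, h⟩
    refine ⟨hφ.inv, ?_⟩
    funext x v w
    have h1 := pullback_inv (ρ := fun _ => 1) hφ (fun x v w => by rw [h, one_mul]) x v w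
    rwa [one_mul] at h1

end General

/-! ### The metric -/

/-- `ℂ^{4n} = ℝ^{8n}`; the coordinate `z^{kn+i}` with `0 ≤ k ≤ 3`, `1 ≤ i ≤ n`, is
`z (k, i)`. -/
abbrev Coord (n : ℕ) : Type := Fin 4 × Fin n → ℂ

variable {n : ℕ}

/-- The quadratic polynomial `σ_{ij} z^i z^{j+n}`. -/
def quadPoly (σ : Matrix (Fin n) (Fin n) ℂ) (z : Coord n) : ℂ :=
  ∑ i, ∑ j, σ i j * z (0, i) * z (1, j)

/-- The Kähler potential
`f = ∑_{a ≤ 2n} (z^a conj(z^{a+2n}) + conj(z^a) z^{a+2n}) + |σ(z)|^2`. -/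
def potential (σ : Matrix (Fin n) (Fin n) ℂ) (z : Coord n) : ℝ :=
  2 * (∑ i, (z (0, i) * conj (z (2, i)) + z (1, i) * conj (z (3, i)))).re
    + Complex.normSq (quadPoly σ z)

/-- The Wirtinger derivative `∂F/∂z^A = (∂F/∂x^A - i ∂F/∂y^A)/2`, where `z^A = x^A + i y^A`. -/
def dz (A : Fin 4 × Fin n) (F : Coord n → ℂ) (z : Coord n) : ℂ :=
  (fderiv ℝ F z (Pi.single A 1) - Complex.I * fderiv ℝ F z (Pi.single A Complex.I)) / 2

/-- The Wirtinger derivative `∂F/∂conj(z^A) = (∂F/∂x^A + i ∂F/∂y^A)/2`. -/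
def dzbar (A : Fin 4 × Fin n) (F : Coord n → ℂ) (z : Coord n) : ℂ :=
  (fderiv ℝ F z (Pi.single A 1) + Complex.I * fderiv ℝ F z (Pi.single A Complex.I)) / 2

/-- The coefficients `h_{AB} = ∂²f / ∂z^A ∂conj(z^B)` of the Kähler metric. -/
def hCoeff (σ : Matrix (Fin n) (Fin n) ℂ) (A B : Fin 4 × Fin n) (z : Coord n) : ℂ :=
  dz A (dzbar B (fun p => (potential σ p : ℂ))) z

/-- The Kähler metric `g = h_{AB} dz^A · dconj(z)^B`. As `f` is real, `h` is Hermitian, and the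
symmetrised product is the real part: `g(v, w) = Re (h_{AB} v^A conj(w^B))`. -/
def metric (σ : Matrix (Fin n) (Fin n) ℂ) (z v w : Coord n) : ℝ :=
  (∑ A, ∑ B, hCoeff σ A B z * v A * conj (w B)).re

/-- The exponents `a, b, a + 2b, 2a + b` of the four diagonal blocks of `φ_{a,b}`. -/
def weight (a b : ℝ) : Fin 4 → ℝ := ![a, b, a + 2 * b, 2 * a + b]

/-- The complex linear map
`φ_{a,b} = diag(e^a 1_n, e^b 1_n, e^{a+2b} 1_n, e^{2a+b} 1_n)` of `ℂ^{4n}`. -/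
def diagMap (a b : ℝ) : Coord n ≃ₗ[ℂ] Coord n where
  toFun z := fun A => (Real.exp (weight a b A.1) : ℂ) * z A
  map_add' z w := by funext A; simp [mul_add]
  map_smul' c z := by funext A; simp [mul_left_comm]
  invFun z := fun A => (Real.exp (-weight a b A.1) : ℂ) * z A
  left_inv z := by
    funext A
    simp only [← mul_assoc, ← Complex.ofReal_mul, ← Real.exp_add]
    simp
  right_inv z := by
    funext A
    simp only [← mul_assoc, ← Complex.ofReal_mul, ← Real.exp_add]
    simp

/-- `φ_{a,b}` as a bijection of `ℂ^{4n} = ℝ^{8n}`. -/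
def phi (n : ℕ) (a b : ℝ) : Equiv.Perm (Coord n) := (diagMap a b : Coord n ≃ₗ[ℂ] Coord n).toEquiv

end ConfGroup

end

/-! ### Abstract model: vanishing Ricci trace and the Hessian of the conformal factor at the origin
-/

noncomputable section

namespace ConfGroup

/-! The metric has the form `g_z(v, w) = G(v, w) + ⟨S(z, v), S(z, w)⟩`, with `G` flat and
nondegenerate and `S(z, ·)` the differential of `σ`. The transpose `K` of `S` takes values in the
kernel of `S`, so the Jacobi operator at the origin squares to zero and has trace zero: Ricci
curvature vanishes there. Isometries (`transvection`) carry the origin to any point.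

The crux is that every conformal map is a homothety. Ricci-flatness on both sides forces `Hess u (v,
v) = (du v)²` at the origin for `G`-null `v`, once the map fixes the origin (`hess_eq_of_jet`,
`hess_conformal_factor`); composing with transvections transports this to every point. Along a
complete line where the identity holds, `e^{-u}` is affine and positive, hence constant. This
applies first to lines in directions `K q w`, which transvections merely translate. After that `u`
cannot distinguish a transvection from a translation, so it is constant along all null lines; null
vectors span, so `u` is constant (`conformal_factor_const`).

The rest is algebra: `φ_{a,b}` scales `G` by `e^{2(a+b)}` and `S` by `e^{a+b}`, so composing a
homothety with a suitable `φ_{s,s}` gives an isometry, and uniqueness of the homothety constant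
makes the decomposition unique. -/

/-- Data defining the metric `g_z(v, w) = G(v, w) + ⟨S(z, v), S(z, w)⟩` on a vector space `E`:
a scalar product `G`, a symmetric bilinear map `S` with values in a Euclidean space, and
the transpose `K z` of `S z` with respect to `G`, whose values lie in the kernel of `S`. -/
structure MetricData (E W : Type*) [NormedAddCommGroup E] [NormedSpace ℝ E]
    [NormedAddCommGroup W] [InnerProductSpace ℝ W] where
  G : E →L[ℝ] E →L[ℝ] ℝ
  S : E →L[ℝ] E →L[ℝ] W
  K : E →L[ℝ] W →L[ℝ] E
  G_symm : ∀ v w, G v w = G w v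
  G_nondeg : ∀ v, (∀ w, G v w = 0) → v = 0
  S_symm : ∀ v w, S v w = S w v
  G_K : ∀ z w c, G (K z w) c = inner ℝ w (S z c)
  S_K : ∀ z w c, S (K z w) c = 0

namespace MetricData

variable {E W : Type*} [NormedAddCommGroup E] [NormedSpace ℝ E]
    [NormedAddCommGroup W] [InnerProductSpace ℝ W] (D : MetricData E W)

/-- The metric `g_z(v, w) = G(v, w) + ⟨S(z, v), S(z, w)⟩`. -/
def g (z v w : E) : ℝ := D.G v w + inner ℝ (D.S z v) (D.S z w)

theorem S_K' (z w c) : D.S c (D.K z w) = 0 := by rw [D.S_symm, D.S_K]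

theorem K_K (z : E) (w w' : W) : D.K (D.K z w) w' = 0 := by
  refine D.G_nondeg _ fun c => ?_
  rw [D.G_K, D.S_K, inner_zero_right]

theorem G_K_K (z z' : E) (w w' : W) : D.G (D.K z w) (D.K z' w') = 0 := by
  rw [D.G_K, D.S_K', inner_zero_right]

theorem G_K' (z w c) : D.G c (D.K z w) = inner ℝ w (D.S z c) := by rw [D.G_symm, D.G_K]

theorem ext_G {v v' : E} (h : ∀ w, D.G v w = D.G v' w) : v = v' := by
  rw [← sub_eq_zero]
  exact D.G_nondeg _ fun w => by simp [h w]

/-- The Jacobi operator `b ↦ K_b S(v, v) - K_v S(v, b)` of the metric at the origin. -/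
def jacobi (v : E) : E →ₗ[ℝ] E where
  toFun b := D.K b (D.S v v) - D.K v (D.S v b)
  map_add' b c := by simp; abel
  map_smul' r b := by simp [smul_sub]

theorem jacobi_apply (v b : E) : D.jacobi v b = D.K b (D.S v v) - D.K v (D.S v b) := rfl

theorem G_jacobi (v b c : E) : D.G (D.jacobi v b) c
    = inner ℝ (D.S v v) (D.S b c) - inner ℝ (D.S v b) (D.S v c) := by
  simp [jacobi_apply, D.G_K]

/-- The operator takes values in the image of `K`, and both of its terms vanish on that image, so
its square is zero. -/
theorem trace_jacobi (v : E) : LinearMap.trace ℝ E (D.jacobi v) = 0 := by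
  have h : D.jacobi v ^ 2 = 0 := by
    ext b
    simp [pow_two, jacobi_apply, D.S_K', D.K_K]
  exact (LinearMap.isNilpotent_trace_of_isNilpotent ⟨2, h⟩).eq_zero

variable [FiniteDimensional ℝ E]

theorem exists_gradient (f : E →ₗ[ℝ] ℝ) : ∃ n, ∀ c, D.G n c = f c := by
  let T : E →ₗ[ℝ] Module.Dual ℝ E := LinearMap.mk₂ ℝ (fun v w => D.G v w)
    (by simp) (by simp) (by simp) (by simp)
  have hT : Function.Injective T := by
    rw [injective_iff_map_eq_zero]
    intro v hv
    exact D.G_nondeg v fun w => LinearMap.congr_fun hv w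
  have hs := (LinearMap.injective_iff_surjective_of_finrank_eq_finrank
    (Subspace.dual_finrank_eq (K := ℝ) (V := E)).symm).1 hT
  obtain ⟨n, hn⟩ := hs f
  exact ⟨n, fun c => LinearMap.congr_fun hn c⟩

/-- The trace of the Gauss equation for a map whose `2`-jet and `3`-jet at the origin are those
of a conformal map with conformal factor `e^{2u}`. -/
theorem hess_eq_of_jet {A : E →ₗ[ℝ] E} {B : E → E → E} {C : E → E → E → E}
    {l : E →ₗ[ℝ] ℝ} {H : E →ₗ[ℝ] E →ₗ[ℝ] ℝ} {s : ℝ} (hs : s ≠ 0)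
    (hB : ∀ a b, B a b = B b a) (hC : ∀ a b c, C a b c = C b a c)
    (hC' : ∀ a b c, C a b c = C a c b)
    (h0 : ∀ b c, D.G (A b) (A c) = s * D.G b c)
    (h1 : ∀ a b c, D.G (A b) (B a c) + D.G (B a b) (A c) = s * (2 * l a) * D.G b c)
    (h2 : ∀ d a b c, D.G (A b) (C d a c) + D.G (B d b) (B a c)
        + (D.G (B a b) (B d c) + D.G (C d a b) (A c))
        + inner ℝ (D.S (A d) (A b)) (D.S (A a) (A c))
        + inner ℝ (D.S (A a) (A b)) (D.S (A d) (A c))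
      = s * (2 * H d a + 4 * l d * l a) * D.G b c
        + s * (inner ℝ (D.S d b) (D.S a c) + inner ℝ (D.S a b) (D.S d c)))
    (hN : 2 < Module.finrank ℝ E) {v : E} (hv : D.G v v = 0) : H v v = l v ^ 2 := by
  obtain ⟨n, hn⟩ := D.exists_gradient l
  have hAinj : Function.Injective A := by
    rw [injective_iff_map_eq_zero]
    intro b hb
    refine D.G_nondeg b fun c => ?_
    have := h0 b c
    rw [hb] at this
    simpa [hs] using this.symm
  let e : E ≃ₗ[ℝ] E := LinearEquiv.ofInjectiveEndo A hAinj
  have he : ∀ b, e b = A b := fun b => rfl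
  -- Koszul's permutation argument: the metric has no first-order term at the origin, so `B` is
  -- determined by `A` and `l` alone.
  have koszul : ∀ a b c, D.G (B a b) (A c)
      = s * (l a * D.G b c + l b * D.G a c - l c * D.G a b) := by
    intro a b c
    have e1 := h1 a b c
    have e2 := h1 b a c
    have e3 := h1 c a b
    rw [hB b a] at e2
    rw [hB c a, hB c b] at e3
    rw [D.G_symm (A b)] at e1
    rw [D.G_symm (A a) (B b c)] at e2
    rw [D.G_symm (A a)] at e3
    linarith
  have hBA : ∀ a b, B a b = A (l a • b + l b • a - D.G a b • n) := by
    intro a b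
    refine D.ext_G fun w => ?_
    obtain ⟨c, rfl⟩ := e.surjective w
    rw [he, koszul, h0]
    simp only [map_add, map_sub, map_smul, add_apply,
      sub_apply, smul_apply, smul_eq_mul, hn]
    ring
  have hBB : ∀ a b c d, D.G (B a b) (B c d) = s * D.G (l a • b + l b • a - D.G a b • n)
      (l c • d + l d • c - D.G c d • n) := by
    intro a b c d
    rw [hBA a b, hBA c d, h0]
  -- The Jacobi operator in direction `A v`, pulled back by `A`; conjugation preserves its zero
  -- trace.
  let R : E →ₗ[ℝ] E := e.symm.conj (D.jacobi (A v))
  have hR : ∀ b c, s * D.G (R b) c = inner ℝ (D.S (A v) (A v)) (D.S (A b) (A c))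
      - inner ℝ (D.S (A v) (A b)) (D.S (A v) (A c)) := by
    intro b c
    rw [← D.G_jacobi, ← h0]
    congr 2
    change A (e.symm (D.jacobi (A v) (e b))) = _
    rw [← he, e.apply_symm_apply, he]
  obtain ⟨m, hm⟩ := D.exists_gradient (H v)
  -- The change of the Jacobi operator under the conformal factor: a multiple of the identity plus
  -- rank-one maps, whose trace can be read off.
  let F : E →ₗ[ℝ] E := (H v v - l v ^ 2) • LinearMap.id + (l v • l - H v).smulRight v
    + (D.G v).toLinearMap.smulRight (l v • n - m - D.G n n • v)
  have key : F = D.jacobi v - R := by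
    ext b
    refine D.ext_G fun c => mul_left_cancel₀ hs ?_
    have hl : D.G (F b) c = (H v v - l v ^ 2) * D.G b c + (l v * l b - H v b) * D.G v c
        + D.G v b * (l v * l c - H v c - D.G n n * D.G v c) := by
      simp [F, hn, hm]
    -- The second derivatives of `g(b,c)`, `g(v,v)`, `g(v,c)` and `g(v,b)` that enter the curvature;
    -- in `e1 + e2 - e3 - e4` the third derivatives `C` cancel.
    have e1 := h2 v v b c
    have e2 := h2 b c v v
    have e3 := h2 v b v c
    have e4 := h2 v c v b
    rw [hBB, hBB, hv] at e2
    rw [hB b v, hC' v b v, hC v b c, hC' b v c, hBB, hBB] at e3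
    rw [hB c v, hB c b, hC' v c v, hC v c b, hC' c v b, hC c b v, hBB, hBB] at e4
    rw [hBB, D.G_symm (A b)] at e1
    rw [D.G_symm (C b c v)] at e2
    rw [D.S_symm b v, D.S_symm c v, D.S_symm (A b) (A v), D.S_symm (A c) (A v),
      real_inner_comm _ (D.S (A v) (A c)), real_inner_comm _ (D.S v c)] at e2
    rw [D.S_symm b v, D.S_symm (A b) (A v)] at e3
    rw [D.S_symm c v, D.S_symm (A c) (A v), D.S_symm c b, D.S_symm (A c) (A b),
      real_inner_comm _ (D.S (A v) (A c)), real_inner_comm _ (D.S v c)] at e4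
    simp only [map_add, map_sub, map_smul, add_apply, sub_apply, smul_apply, smul_eq_mul, hn,
      hv, D.G_symm b v, D.G_symm c v, D.G_symm c b, fun x => D.G_symm x n] at e1 e2 e3 e4
    have e5 := hR b c
    rw [hl, LinearMap.sub_apply, map_sub, sub_apply, D.G_jacobi]
    linear_combination (-1 / 2) * (e1 + e2 - e3 - e4) + e5 - s * D.G v b * D.G v c * hn n
  have htr := congrArg (LinearMap.trace ℝ E) key
  have hRt : LinearMap.trace ℝ E R = 0 := by
    rw [LinearMap.trace_conj', D.trace_jacobi]
  rw [map_sub, D.trace_jacobi, hRt] at htr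
  have hF : LinearMap.trace ℝ E F
      = (H v v - l v ^ 2) * ((Module.finrank ℝ E : ℝ) - 2) := by
    simp only [F, map_add, map_smul, LinearMap.trace_id, LinearMap.trace_smulRight]
    simp [hv, D.G_symm v, hn, hm]
    ring
  rw [hF, sub_zero] at htr
  have h2N : (2 : ℝ) < Module.finrank ℝ E := by exact_mod_cast hN
  rcases mul_eq_zero.1 htr with h | h <;> linarith

end MetricData
end ConfGroup

/-! ### Differentiating the conformal equation twice at a fixed origin -/

namespace ConfGroup
namespace MetricData

variable {E W : Type*} [NormedAddCommGroup E] [NormedSpace ℝ E]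
    [NormedAddCommGroup W] [InnerProductSpace ℝ W] (D : MetricData E W)

theorem hasDerivAt_comp_line {F : Type*} [NormedAddCommGroup F] [NormedSpace ℝ F] {f : E → F}
    (hf : Differentiable ℝ f) (z a : E) (t : ℝ) :
    HasDerivAt (fun t : ℝ => f (z + t • a)) (fderiv ℝ f (z + t • a) a) t := by
  have h : HasDerivAt (fun t : ℝ => z + t • a) a t := by
    simpa using ((hasDerivAt_id t).smul_const a).const_add z
  exact (hf (z + t • a)).hasFDerivAt.comp_hasDerivAt t h

theorem fderiv_fderiv_symm {F : Type*} [NormedAddCommGroup F] [NormedSpace ℝ F] {f : E → F}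
    (hf : ContDiff ℝ ∞ f) (z a b : E) :
    fderiv ℝ (fderiv ℝ f) z a b = fderiv ℝ (fderiv ℝ f) z b a :=
  (hf.contDiffAt (x := z)).isSymmSndFDerivAt
    (by rw [minSmoothness_of_isRCLikeNormedField]; exact WithTop.coe_le_coe.2 le_top) a b

theorem hasDerivAt_bilin {F G H : Type*} [NormedAddCommGroup F] [NormedSpace ℝ F]
    [NormedAddCommGroup G] [NormedSpace ℝ G] [NormedAddCommGroup H] [NormedSpace ℝ H]
    (B : F →L[ℝ] G →L[ℝ] H) {f : ℝ → F} {h : ℝ → G} {f' : F} {h' : G} {t : ℝ}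
    (hf : HasDerivAt f f' t) (hh : HasDerivAt h h' t) :
    HasDerivAt (fun t => B (f t) (h t)) (B (f t) h' + B f' (h t)) t :=
  (B.hasFDerivAt_of_bilinear hf.hasFDerivAt hh.hasFDerivAt).hasDerivAt.congr_deriv (by simp)

variable [FiniteDimensional ℝ E]

theorem hess_conformal_factor (hN : 2 < Module.finrank ℝ E) {φ : E → E} {u : E → ℝ}
    (hφ : ContDiff ℝ ∞ φ) (hu : ContDiff ℝ ∞ u) (hφ0 : φ 0 = 0)
    (h : ∀ z v w, D.g (φ z) (fderiv ℝ φ z v) (fderiv ℝ φ z w)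
      = Real.exp (2 * u z) * D.g z v w) {v : E} (hv : D.G v v = 0) :
    fderiv ℝ (fderiv ℝ u) 0 v v = (fderiv ℝ u 0 v) ^ 2 := by
  have dφ : Differentiable ℝ φ := hφ.differentiable (by simp)
  have cφ1 : ContDiff ℝ ∞ (fderiv ℝ φ) := hφ.fderiv_right (by simp)
  have cφ2 : ContDiff ℝ ∞ (fderiv ℝ (fderiv ℝ φ)) := cφ1.fderiv_right (by simp)
  have du : Differentiable ℝ u := hu.differentiable (by simp)
  have cu1 : ContDiff ℝ ∞ (fderiv ℝ u) := hu.fderiv_right (by simp)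
  have dφ1 := cφ1.differentiable (by simp)
  have dφ2 := cφ2.differentiable (by simp)
  have du1 := cu1.differentiable (by simp)
  have L0 : ∀ (z a : E) (t : ℝ), HasDerivAt (fun t : ℝ => z + t • a) a t := fun z a t =>
    by simpa using ((hasDerivAt_id t).smul_const a).const_add z
  have L1 : ∀ z a b t, HasDerivAt (fun t : ℝ => fderiv ℝ φ (z + t • a) b)
      (fderiv ℝ (fderiv ℝ φ) (z + t • a) a b) t := fun z a b t => by
    simpa using (hasDerivAt_comp_line dφ1 z a t).clm_apply (hasDerivAt_const t b)
  have L2 : ∀ z d a b t, HasDerivAt (fun t : ℝ => fderiv ℝ (fderiv ℝ φ) (z + t • d) a b)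
      (fderiv ℝ (fderiv ℝ (fderiv ℝ φ)) (z + t • d) d a b) t := fun z d a b t => by
    simpa using ((hasDerivAt_comp_line dφ2 z d t).clm_apply (hasDerivAt_const t a)).clm_apply
      (hasDerivAt_const t b)
  have U1 : ∀ z a b t, HasDerivAt (fun t : ℝ => fderiv ℝ u (z + t • a) b)
      (fderiv ℝ (fderiv ℝ u) (z + t • a) a b) t := fun z a b t => by
    simpa using (hasDerivAt_comp_line du1 z a t).clm_apply (hasDerivAt_const t b)
  have X : ∀ z a t, HasDerivAt (fun t : ℝ => Real.exp (2 * u (z + t • a)))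
      (Real.exp (2 * u (z + t • a)) * (2 * fderiv ℝ u (z + t • a) a)) t := fun z a t =>
    ((hasDerivAt_comp_line du z a t).const_mul 2).exp
  have SL : ∀ z a b t, HasDerivAt (fun t : ℝ => D.S (z + t • a) b) (D.S a b) t :=
    fun z a b t => by
      simpa using hasDerivAt_bilin D.S (L0 z a t) (hasDerivAt_const t b)
  -- Kept at arbitrary `z` so that it can be differentiated once more; the terms in `S (φ z)` and `S
  -- z` disappear only at the origin.
  have first : ∀ z a b c : E,
      D.G (fderiv ℝ φ z b) (fderiv ℝ (fderiv ℝ φ) z a c)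
        + D.G (fderiv ℝ (fderiv ℝ φ) z a b) (fderiv ℝ φ z c)
        + (inner ℝ (D.S (φ z) (fderiv ℝ φ z b)) (D.S (φ z) (fderiv ℝ (fderiv ℝ φ) z a c)
            + D.S (fderiv ℝ φ z a) (fderiv ℝ φ z c))
          + inner ℝ (D.S (φ z) (fderiv ℝ (fderiv ℝ φ) z a b)
            + D.S (fderiv ℝ φ z a) (fderiv ℝ φ z b)) (D.S (φ z) (fderiv ℝ φ z c)))
      = Real.exp (2 * u z) * (2 * fderiv ℝ u z a)
          * (D.G b c + inner ℝ (D.S z b) (D.S z c))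
        + Real.exp (2 * u z)
          * (inner ℝ (D.S z b) (D.S a c) + inner ℝ (D.S a b) (D.S z c)) := by
    intro z a b c
    have l := (hasDerivAt_bilin D.G (L1 z a b 0) (L1 z a c 0)).add
      ((hasDerivAt_bilin D.S (hasDerivAt_comp_line dφ z a 0) (L1 z a b 0)).inner ℝ
        (hasDerivAt_bilin D.S (hasDerivAt_comp_line dφ z a 0) (L1 z a c 0)))
    have r := (X z a 0).mul (((SL z a b 0).inner ℝ (SL z a c 0)).const_add (D.G b c))
    have := l.unique (r.congr_of_eventuallyEq (Filter.Eventually.of_forall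
      fun t => h (z + t • a) b c))
    simpa using this
  have second := fun d a b c : E => by
    have l := ((hasDerivAt_bilin D.G (L1 0 d b 0) (L2 0 d a c 0)).add
        (hasDerivAt_bilin D.G (L2 0 d a b 0) (L1 0 d c 0))).add
      (((hasDerivAt_bilin D.S (hasDerivAt_comp_line dφ 0 d 0) (L1 0 d b 0)).inner ℝ
        ((hasDerivAt_bilin D.S (hasDerivAt_comp_line dφ 0 d 0) (L2 0 d a c 0)).add
          (hasDerivAt_bilin D.S (L1 0 d a 0) (L1 0 d c 0)))).add
      (((hasDerivAt_bilin D.S (hasDerivAt_comp_line dφ 0 d 0) (L2 0 d a b 0)).add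
          (hasDerivAt_bilin D.S (L1 0 d a 0) (L1 0 d b 0))).inner ℝ
        (hasDerivAt_bilin D.S (hasDerivAt_comp_line dφ 0 d 0) (L1 0 d c 0))))
    have r := ((((X 0 d 0).mul ((U1 0 d a 0).const_mul 2)).mul
        (((SL 0 d b 0).inner ℝ (SL 0 d c 0)).const_add (D.G b c)))).add
      ((X 0 d 0).mul (((SL 0 d b 0).inner ℝ (hasDerivAt_const 0 (D.S a c))).add
        ((hasDerivAt_const 0 (D.S a b)).inner ℝ (SL 0 d c 0))))
    exact l.unique (r.congr_of_eventuallyEq (Filter.Eventually.of_forall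
      fun t => first (0 + t • d) a b c))
  refine D.hess_eq_of_jet (A := (fderiv ℝ φ 0).toLinearMap)
    (B := fun a b => fderiv ℝ (fderiv ℝ φ) 0 a b)
    (C := fun a b c => fderiv ℝ (fderiv ℝ (fderiv ℝ φ)) 0 a b c)
    (l := (fderiv ℝ u 0).toLinearMap)
    (H := LinearMap.mk₂ ℝ (fun a b => fderiv ℝ (fderiv ℝ u) 0 a b)
      (by simp) (by simp) (by simp) (by simp))
    (s := Real.exp (2 * u 0)) (Real.exp_ne_zero _) ?_ ?_ ?_ ?_ ?_ ?_ hN hv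
  · intro a b
    exact fderiv_fderiv_symm hφ 0 a b
  · intro a b c
    exact congrArg (fun T => T c) (fderiv_fderiv_symm cφ1 0 a b)
  · intro a b c
    -- Symmetry in the last two slots comes from differentiating the symmetry of the second
    -- derivative along a line.
    refine (L2 0 a b c 0).unique ?_ |> fun e => by simpa using e
    simp_rw [fderiv_fderiv_symm hφ _ b c]
    simpa using L2 0 a c b 0
  · intro b c
    simpa [g, hφ0] using h 0 b c
  · intro a b c
    simpa [hφ0] using first 0 a b c
  · intro d a b c
    have := second d a b c
    simp [hφ0] at this
    simp
    linear_combination this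

end MetricData
end ConfGroup

/-! ### Transvections and constancy of the conformal factor -/

namespace ConfGroup
namespace MetricData

variable {E W : Type*} [NormedAddCommGroup E] [NormedSpace ℝ E]
    [NormedAddCommGroup W] [InnerProductSpace ℝ W] (D : MetricData E W)

/-- The transvection of the symmetric space `(E, g)`, an isometry translating the kernel of `S`
and carrying `0` to `a`. -/
def transvection (a z : E) : E :=
  z + a - (1 / 2 : ℝ) • D.K a (D.S z z) - (1 / 2 : ℝ) • D.K a (D.S a z)

theorem transvection_zero (a : E) : D.transvection a 0 = a := by simp [transvection]

theorem transvection_neg_self (a : E) : D.transvection (-a) a = 0 := by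
  simp [transvection]

theorem contDiff_transvection (a : E) : ContDiff ℝ ∞ (D.transvection a) := by
  have h1 : ContDiff ℝ ∞ (fun z => D.S z z) := D.S.contDiff.clm_apply contDiff_id
  have h2 : ContDiff ℝ ∞ (fun z => D.S a z) := (D.S a).contDiff
  exact ((contDiff_id.add contDiff_const).sub (((D.K a).contDiff.comp h1).const_smul _)).sub
    (((D.K a).contDiff.comp h2).const_smul _)

theorem fderiv_transvection (a z v : E) : fderiv ℝ (D.transvection a) z v
    = v - D.K a (D.S z v) - (1 / 2 : ℝ) • D.K a (D.S a v) := by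
  have hd := (D.contDiff_transvection a).differentiable (by simp)
  have h := hasDerivAt_comp_line hd z v 0
  have L0 : HasDerivAt (fun t : ℝ => z + t • v) v 0 := by
    simpa using ((hasDerivAt_id (0 : ℝ)).smul_const v).const_add z
  have h1 := (D.K a).hasFDerivAt.comp_hasDerivAt (0 : ℝ) (hasDerivAt_bilin D.S L0 L0)
  have h2 := (D.K a).hasFDerivAt.comp_hasDerivAt (0 : ℝ)
    ((D.S a).hasFDerivAt.comp_hasDerivAt (0 : ℝ) L0)
  have h' := ((L0.add_const a).sub (h1.const_smul (1 / 2 : ℝ))).sub (h2.const_smul (1 / 2 : ℝ))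
  have e := h.unique h'
  simp only [zero_smul, add_zero] at e
  rw [e, D.S_symm v z, map_add, ← two_smul ℝ, smul_smul]
  norm_num

theorem g_transvection (a z v w : E) :
    D.g (D.transvection a z) (fderiv ℝ (D.transvection a) z v)
      (fderiv ℝ (D.transvection a) z w) = D.g z v w := by
  -- The corrections in the transvection lie in the image of `K`, invisible to `S`. Hence `S` sees
  -- only a translation, and the cross terms this creates are cancelled by the change in `G`.
  have hS : ∀ v, D.S (D.transvection a z) (fderiv ℝ (D.transvection a) z v)
      = D.S z v + D.S a v := fun v => by
    rw [fderiv_transvection]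
    simp [transvection, D.S_K, D.S_K']
  rw [g, g, hS, hS, fderiv_transvection, fderiv_transvection]
  simp only [map_sub, map_smul, sub_apply, smul_apply, D.G_K, D.G_K', D.S_K', inner_add_left,
    inner_add_right, inner_zero_right, sub_zero, smul_eq_mul, mul_zero]
  rw [real_inner_comm (D.S a v) (D.S z w), real_inner_comm (D.S a v) (D.S a w)]
  ring

/-- Needed where a transvection is known to agree with a translation on a single line only. -/
theorem eq_hess_of_eq_on_line {f h : E → ℝ} (hf : ContDiff ℝ ∞ f) (hh : ContDiff ℝ ∞ h)
    {p q v : E} (e : ∀ t : ℝ, f (p + t • v) = h (q + t • v)) :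
    fderiv ℝ f p v = fderiv ℝ h q v ∧
      fderiv ℝ (fderiv ℝ f) p v v = fderiv ℝ (fderiv ℝ h) q v v := by
  have df : Differentiable ℝ f := hf.differentiable (by simp)
  have df1 : Differentiable ℝ (fderiv ℝ f) :=
    ContDiff.differentiable (n := ∞) (hf.fderiv_right (by simp)) (by simp)
  have dh : Differentiable ℝ h := hh.differentiable (by simp)
  have dh1 : Differentiable ℝ (fderiv ℝ h) :=
    ContDiff.differentiable (n := ∞) (hh.fderiv_right (by simp)) (by simp)
  have e1 : ∀ t : ℝ, fderiv ℝ f (p + t • v) v = fderiv ℝ h (q + t • v) v := fun t =>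
    (hasDerivAt_comp_line df p v t).unique
      ((hasDerivAt_comp_line dh q v t).congr_of_eventuallyEq (Filter.Eventually.of_forall e))
  have e2 := ((hasDerivAt_comp_line df1 p v 0).clm_apply (hasDerivAt_const 0 v)).unique
    (((hasDerivAt_comp_line dh1 q v 0).clm_apply (hasDerivAt_const 0 v)).congr_of_eventuallyEq
      (Filter.Eventually.of_forall e1))
  exact ⟨by simpa using e1 0, by simpa using e2⟩

theorem eq_of_pos_of_deriv_deriv_eq_zero {f : ℝ → ℝ} {f' : ℝ → ℝ} (hpos : ∀ t, 0 < f t)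
    (h1 : ∀ t, HasDerivAt f (f' t) t) (h2 : ∀ t, HasDerivAt f' 0 t) (t : ℝ) : f t = f 0 := by
  have hc : ∀ t, f' t = f' 0 := fun t =>
    is_const_of_deriv_eq_zero (fun t => (h2 t).differentiableAt) (fun t => (h2 t).deriv) t 0
  have haff : ∀ t, f t - f' 0 * t = f 0 := fun t => by
    have hd : ∀ t, HasDerivAt (fun t => f t - f' 0 * t) 0 t := fun t => by
      exact ((h1 t).sub ((hasDerivAt_id t).const_mul (f' 0))).congr_deriv (by simp [hc t])
    simpa using is_const_of_deriv_eq_zero (fun t => (hd t).differentiableAt)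
      (fun t => (hd t).deriv) t 0
  by_cases h0 : f' 0 = 0
  · simpa [h0] using haff t
  · exfalso
    -- The zero of the affine function `f`, contradicting positivity.
    have := haff (-(f 0) / f' 0)
    have hp := hpos (-(f 0) / f' 0)
    rw [mul_div_cancel₀ _ h0] at this
    linarith

/-- A smooth function `u` for which `e^{-u}` has vanishing second derivatives along a line is
constant on it. -/
theorem eq_of_hess_eq_sq {u : E → ℝ} (hu : ContDiff ℝ ∞ u) (p v : E)
    (h : ∀ t : ℝ, fderiv ℝ (fderiv ℝ u) (p + t • v) v v = (fderiv ℝ u (p + t • v) v) ^ 2) :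
    u (p + v) = u p := by
  have du : Differentiable ℝ u := hu.differentiable (by simp)
  have du1 : Differentiable ℝ (fderiv ℝ u) :=
    ContDiff.differentiable (n := ∞) (hu.fderiv_right (by simp)) (by simp)
  have U1 : ∀ t, HasDerivAt (fun t : ℝ => fderiv ℝ u (p + t • v) v)
      (fderiv ℝ (fderiv ℝ u) (p + t • v) v v) t := fun t => by
    simpa using (hasDerivAt_comp_line du1 p v t).clm_apply (hasDerivAt_const t v)
  have X := fun t => (hasDerivAt_comp_line du p v t).neg.exp
  have e := eq_of_pos_of_deriv_deriv_eq_zero (fun t => Real.exp_pos _) X (fun t => by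
    refine ((X t).mul (U1 t).neg).congr_deriv ?_
    rw [h t]
    simp
    ring) 1
  simpa using e

variable [FiniteDimensional ℝ E]

/-- Apply the result at the origin to `T_{-φ(p)} ∘ φ ∘ T_p`, which fixes `0` and has conformal
factor `u ∘ T_p` because transvections are isometries. -/
theorem hess_conformal_factor_transvection (hN : 2 < Module.finrank ℝ E) {φ : E → E} {u : E → ℝ}
    (hφ : ContDiff ℝ ∞ φ) (hu : ContDiff ℝ ∞ u)
    (h : ∀ z v w, D.g (φ z) (fderiv ℝ φ z v) (fderiv ℝ φ z w)
      = Real.exp (2 * u z) * D.g z v w) (p : E) {v : E} (hv : D.G v v = 0) :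
    fderiv ℝ (fderiv ℝ (u ∘ D.transvection p)) 0 v v
      = (fderiv ℝ (u ∘ D.transvection p) 0 v) ^ 2 := by
  have dT : ∀ q, Differentiable ℝ (D.transvection q) := fun q =>
    (D.contDiff_transvection q).differentiable (by simp)
  have dφ := hφ.differentiable (by simp)
  refine D.hess_conformal_factor hN
    (φ := D.transvection (-(φ p)) ∘ (φ ∘ D.transvection p))
    ((D.contDiff_transvection _).comp (hφ.comp (D.contDiff_transvection p)))
    (hu.comp (D.contDiff_transvection p)) ?_ ?_ hv
  · simp [transvection_zero, transvection_neg_self]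
  · intro z v w
    rw [fderiv_comp z (dT _ _) ((dφ _).comp z (dT _ _)), fderiv_comp z (dφ _) (dT _ _)]
    simp only [ContinuousLinearMap.comp_apply, Function.comp_apply]
    rw [g_transvection, h, g_transvection]

theorem conformal_factor_const (hN : 2 < Module.finrank ℝ E)
    (hspan : Submodule.span ℝ {v | D.G v v = 0} = ⊤) {φ : E → E} {u : E → ℝ}
    (hφ : ContDiff ℝ ∞ φ) (hu : ContDiff ℝ ∞ u)
    (h : ∀ z v w, D.g (φ z) (fderiv ℝ φ z v) (fderiv ℝ φ z w)
      = Real.exp (2 * u z) * D.g z v w) (z : E) : u z = u 0 := by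
  -- `K q w` is null and lies in the kernel of `S`, so the transvection translates this line and the
  -- identity for `u ∘ T` becomes one for `u` itself.
  have hK : ∀ p q w, u (p + D.K q w) = u p := by
    intro p q w
    refine eq_of_hess_eq_sq hu p (D.K q w) fun t => ?_
    have := D.hess_conformal_factor_transvection hN hφ hu h (p + t • D.K q w)
      (v := D.K q w) (D.G_K_K _ _ _ _)
    obtain ⟨e1, e2⟩ := eq_hess_of_eq_on_line (p := 0) (q := p + t • D.K q w) (v := D.K q w)
      (hu.comp (D.contDiff_transvection (p + t • D.K q w))) hu (fun t' => by
        simp [transvection, D.S_K, D.S_K', add_comm])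
    rw [← e1, ← e2, this]
  -- A transvection differs from the translation by `p` by vectors in the image of `K p`, which `u`
  -- ignores by `hK`.
  have hT : ∀ p z, u (D.transvection p z) = u (z + p) := by
    intro p z
    rw [transvection, ← map_smul (D.K p), ← map_smul (D.K p), sub_eq_add_neg, sub_eq_add_neg, ← map_neg, ← map_neg,
      hK, hK]
  have hnull : ∀ p v, D.G v v = 0 → u (p + v) = u p := by
    intro p v hv
    refine eq_of_hess_eq_sq hu p v fun t => ?_
    have := D.hess_conformal_factor_transvection hN hφ hu h (p + t • v) hv
    have hc : u ∘ D.transvection (p + t • v) = fun z => u (z + (p + t • v)) :=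
      funext fun z => hT _ z
    rw [hc, funext fun z => fderiv_comp_add_right (𝕜 := ℝ) (f := u) (x := z) (p + t • v)] at this
    rw [fderiv_comp_add_right (𝕜 := ℝ) (f := fderiv ℝ u)] at this
    simpa using this
  have hz : z ∈ Submodule.span ℝ {v | D.G v v = 0} := by rw [hspan]; trivial
  -- Quantifying over base point and scale lets the span induction pass through sums and multiples.
  have : ∀ (r : ℝ) (p : E), u (p + r • z) = u p := by
    induction hz using Submodule.span_induction with
    | mem v hv => exact fun r p => hnull p _ (by simp [show D.G v v = 0 from hv])
    | zero => simp
    | add v w _ _ hv hw => exact fun r p => by rw [smul_add, ← add_assoc, hw, hv]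
    | smul r v _ hv => exact fun s p => by rw [smul_smul, hv]
  simpa using this 1 0

end MetricData
end ConfGroup

/-! ### The Kähler metric in the abstract form -/

namespace ConfGroup

variable {n : ℕ} (σ : Matrix (Fin n) (Fin n) ℂ)

/-- The Hessian of `σ(z)`, so that `dσ_z(v) = S(z, v)`. -/
def quadHess : Coord n →ₗ[ℂ] Coord n →ₗ[ℂ] ℂ :=
  LinearMap.mk₂ ℂ (fun z v => ∑ i, ∑ j, σ i j * (z (0, i) * v (1, j) + v (0, i) * z (1, j)))
    (fun z z' v => by
      simp only [← Finset.sum_add_distrib]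
      exact Finset.sum_congr rfl fun i _ => Finset.sum_congr rfl fun j _ => by simp; ring)
    (fun c z v => by
      simp only [Finset.smul_sum]
      exact Finset.sum_congr rfl fun i _ => Finset.sum_congr rfl fun j _ => by simp; ring)
    (fun z v v' => by
      simp only [← Finset.sum_add_distrib]
      exact Finset.sum_congr rfl fun i _ => Finset.sum_congr rfl fun j _ => by simp; ring)
    (fun c z v => by
      simp only [Finset.smul_sum]
      exact Finset.sum_congr rfl fun i _ => Finset.sum_congr rfl fun j _ => by simp; ring)

theorem quadHess_apply (z v : Coord n) : quadHess σ z v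
    = ∑ i, ∑ j, σ i j * (z (0, i) * v (1, j) + v (0, i) * z (1, j)) := rfl

theorem quadHess_symm (z v : Coord n) : quadHess σ z v = quadHess σ v z := by
  simp only [quadHess_apply]
  exact Finset.sum_congr rfl fun i _ => Finset.sum_congr rfl fun j _ => by ring

theorem quadHess_self (z : Coord n) : quadHess σ z z = 2 * quadPoly σ z := by
  simp only [quadHess_apply, quadPoly, Finset.mul_sum]
  exact Finset.sum_congr rfl fun i _ => Finset.sum_congr rfl fun j _ => by ring

/-- The flat Hermitian form
`∑_{a ≤ 2n} (z^a conj(w^{a+2n}) + z^{a+2n} conj(w^a))`. -/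
def flatForm : Coord n →ₗ[ℂ] Coord n →ₛₗ[starRingEnd ℂ] ℂ :=
  LinearMap.mk₂'ₛₗ (RingHom.id ℂ) (starRingEnd ℂ)
    (fun z w => ∑ A, z A * conj (w (A.1 + 2, A.2)))
    (fun z z' w => by simp [add_mul, Finset.sum_add_distrib])
    (fun c z w => by simp [Finset.mul_sum, mul_assoc])
    (fun z w w' => by simp [mul_add, Finset.sum_add_distrib])
    (fun c z w => by simp [Finset.mul_sum, mul_left_comm])

theorem flatForm_apply (z w : Coord n) :
    flatForm z w = ∑ A, z A * conj (w (A.1 + 2, A.2)) := rfl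

theorem sum_add_two {M : Type*} [AddCommMonoid M] (f : Fin 4 × Fin n → M) :
    ∑ A : Fin 4 × Fin n, f (A.1 + 2, A.2) = ∑ A, f A :=
  Equiv.sum_comp ((Equiv.addRight (2 : Fin 4)).prodCongr (Equiv.refl (Fin n))) f

theorem add_two_add_two (k : Fin 4) : k + 2 + 2 = k := by
  fin_cases k <;> rfl

theorem flatForm_conj (z w : Coord n) : conj (flatForm z w) = flatForm w z := by
  rw [flatForm_apply, flatForm_apply, ← sum_add_two, map_sum]
  exact Finset.sum_congr rfl fun A _ => by simp [add_two_add_two, mul_comm]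

/-- The transpose of `v ↦ S(z, v)` with respect to the flat form. -/
def quadTranspose (z : Coord n) (w : ℂ) : Coord n := fun A =>
  ![0, 0, w * conj (∑ j, σ A.2 j * z (1, j)), w * conj (∑ i, σ i A.2 * z (0, i))] A.1

theorem sum_coord {M : Type*} [AddCommMonoid M] (f : Fin 4 × Fin n → M) :
    ∑ A, f A = ∑ i, f (0, i) + ∑ i, f (1, i) + ∑ i, f (2, i) + ∑ i, f (3, i) := by
  rw [Fintype.sum_prod_type, Fin.sum_univ_four]

theorem flatForm_quadTranspose (z c : Coord n) (w : ℂ) :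
    flatForm (quadTranspose σ z w) c = w * conj (quadHess σ z c) := by
  have h : quadHess σ z c = ∑ i, (∑ j, σ i j * z (1, j)) * c (0, i)
      + ∑ j, (∑ i, σ i j * z (0, i)) * c (1, j) := by
    simp only [quadHess_apply, mul_add, Finset.sum_add_distrib, Finset.sum_mul]
    rw [add_comm]
    congr 1
    · exact Finset.sum_congr rfl fun i _ => Finset.sum_congr rfl fun j _ => by ring
    · rw [Finset.sum_comm]
      exact Finset.sum_congr rfl fun i _ => Finset.sum_congr rfl fun j _ => by ring
  rw [h, flatForm_apply, sum_coord]
  simp only [quadTranspose, map_add, map_sum (starRingEnd ℂ), map_mul, mul_add]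
  rw [Finset.mul_sum, Finset.mul_sum]
  simp [mul_assoc]

theorem quadHess_quadTranspose (z c : Coord n) (w : ℂ) :
    quadHess σ (quadTranspose σ z w) c = 0 := by
  simp [quadHess_apply, quadTranspose]

/-- The real bilinear maps defining the metric of `ℂ^{4n}`. -/
def metricData : MetricData (Coord n) ℂ where
  G := (LinearMap.mk₂ ℝ (fun v w : Coord n => (flatForm v w).re) (by simp) (by simp)
    (by simp) (fun c v w => by
      have : c • w = (c : ℂ) • w := rfl
      rw [this, map_smulₛₗ]
      simp)).toContinuousBilinearMap
  S := (LinearMap.mk₂ ℝ (fun v w : Coord n => quadHess σ v w) (by simp) (by simp)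
    (by simp) (by simp)).toContinuousBilinearMap
  K := (LinearMap.mk₂ ℝ (fun (v : Coord n) (w : ℂ) => quadTranspose σ v w)
    (fun z z' w => by
      funext ⟨k, i⟩
      fin_cases k <;> simp [quadTranspose, mul_add, Finset.sum_add_distrib])
    (fun c z w => by
      funext ⟨k, i⟩
      fin_cases k <;> simp [quadTranspose, Finset.mul_sum, mul_left_comm])
    (fun z w w' => by
      funext ⟨k, i⟩
      fin_cases k <;> simp [quadTranspose, add_mul])
    (fun c z w => by
      funext ⟨k, i⟩
      fin_cases k <;> simp [quadTranspose, mul_assoc])).toContinuousBilinearMap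
  G_symm v w := by
    simp only [LinearMap.toContinuousBilinearMap_apply, LinearMap.mk₂_apply]
    rw [← flatForm_conj, Complex.conj_re]
  G_nondeg v h := by
    simp only [LinearMap.toContinuousBilinearMap_apply, LinearMap.mk₂_apply] at h
    -- Pairing `v` with itself after swapping its two halves turns the neutral form into `∑ |v A|²`.
    have h1 := h fun A => v (A.1 + 2, A.2)
    simp only [flatForm_apply, add_two_add_two, Complex.mul_conj, Complex.re_sum,
      Complex.ofReal_re] at h1
    rw [Finset.sum_eq_zero_iff_of_nonneg fun A _ => Complex.normSq_nonneg _] at h1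
    funext A
    simpa using h1 A (Finset.mem_univ A)
  S_symm v w := quadHess_symm σ v w
  G_K z w c := by
    simp only [LinearMap.toContinuousBilinearMap_apply, LinearMap.mk₂_apply]
    rw [flatForm_quadTranspose, Complex.inner, mul_comm, Complex.mul_re, Complex.mul_re]
    simp
  S_K z w c := quadHess_quadTranspose σ z c w

theorem metricData_G (v w : Coord n) : (metricData σ).G v w = (flatForm v w).re := rfl

theorem metricData_S (v w : Coord n) : (metricData σ).S v w = quadHess σ v w := rfl

theorem potential_eq (z : Coord n) : potential σ z
    = (metricData σ).G z z + 1 / 4 * inner ℝ ((metricData σ).S z z) ((metricData σ).S z z) := by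
  have h : (flatForm z z).re
      = 2 * (∑ i, (z (0, i) * conj (z (2, i)) + z (1, i) * conj (z (3, i)))).re := by
    rw [flatForm_apply, sum_coord]
    simp only [Complex.add_re, Complex.re_sum, ← Finset.sum_add_distrib, Finset.mul_sum]
    refine Finset.sum_congr rfl fun i _ => ?_
    have h2 : (2 : Fin 4) + 2 = 0 := rfl
    have h3 : (3 : Fin 4) + 2 = 1 := rfl
    have h1 : (1 : Fin 4) + 2 = 3 := rfl
    simp only [zero_add, h1, h2, h3, Complex.mul_re, Complex.conj_re, Complex.conj_im]
    ring
  rw [metricData_G, metricData_S, quadHess_self, h, potential, real_inner_self_eq_norm_sq,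
    norm_mul, mul_pow, Complex.normSq_eq_norm_sq]
  norm_num
  ring

theorem contDiff_potential : ContDiff ℝ ∞ (fun p => (potential σ p : ℂ)) := by
  have hG : ContDiff ℝ ∞ fun z => (metricData σ).G z z :=
    (metricData σ).G.contDiff.clm_apply contDiff_id
  have hS : ContDiff ℝ ∞ fun z => (metricData σ).S z z :=
    (metricData σ).S.contDiff.clm_apply contDiff_id
  simp only [potential_eq]
  exact Complex.ofRealCLM.contDiff.comp (hG.add (contDiff_const.mul (hS.inner ℝ hS)))

theorem fderiv_potential (z v : Coord n) : fderiv ℝ (fun p => (potential σ p : ℂ)) z v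
    = ((2 * (metricData σ).G z v
      + inner ℝ ((metricData σ).S z z) ((metricData σ).S z v) : ℝ) : ℂ) := by
  have L0 : HasDerivAt (fun t : ℝ => z + t • v) v 0 := by
    simpa using ((hasDerivAt_id (0 : ℝ)).smul_const v).const_add z
  have h1 := MetricData.hasDerivAt_comp_line
    ((contDiff_potential σ).differentiable (by simp)) z v 0
  have hS := MetricData.hasDerivAt_bilin (metricData σ).S L0 L0
  have h2 := ((MetricData.hasDerivAt_bilin (metricData σ).G L0 L0).add
    ((hS.inner ℝ hS).const_mul (1 / 4))).ofReal_comp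
  simp only [potential_eq] at h1 ⊢
  have e := h1.unique h2
  simp only [zero_smul, add_zero] at e
  rw [e, (metricData σ).S_symm v z, (metricData σ).G_symm v z, real_inner_comm _
    ((metricData σ).S z v + _), inner_add_right]
  congr 1
  ring

theorem dzbar_potential (B : Fin 4 × Fin n) (z : Coord n) :
    dzbar B (fun p => (potential σ p : ℂ)) z
      = flatForm z (Pi.single B 1)
        + 1 / 2 * (quadHess σ z z * conj (quadHess σ z (Pi.single B 1))) := by
  have hI : (Pi.single B Complex.I : Coord n) = Complex.I • Pi.single B 1 := by
    rw [← Pi.single_smul, smul_eq_mul, mul_one]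
  rw [dzbar, fderiv_potential, fderiv_potential, hI]
  simp only [metricData_G, metricData_S, map_smul, map_smulₛₗ, smul_eq_mul, Complex.inner,
    Complex.conj_I]
  apply Complex.ext <;> simp <;> ring

theorem fderiv_dzbar_potential (B : Fin 4 × Fin n) (z v : Coord n) :
    fderiv ℝ (dzbar B (fun p => (potential σ p : ℂ))) z v
      = flatForm v (Pi.single B 1)
        + (quadHess σ z v * conj (quadHess σ z (Pi.single B 1))
        + 1 / 2 * (quadHess σ z z * conj (quadHess σ v (Pi.single B 1)))) := by
  have e : dzbar B (fun p => (potential σ p : ℂ)) = fun z => flatForm z (Pi.single B 1)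
        + 1 / 2 * (quadHess σ z z * conj (quadHess σ z (Pi.single B 1))) :=
    funext (dzbar_potential σ B)
  generalize (Pi.single B 1 : Coord n) = b at e ⊢
  have df : Differentiable ℝ fun z : Coord n => flatForm z b := by
    simp only [flatForm_apply]
    fun_prop
  have dq : ∀ c : Coord n → Coord n, Differentiable ℝ c →
      Differentiable ℝ fun z => quadHess σ z (c z) := fun c hc => by
    simp only [quadHess_apply]
    fun_prop
  have hd : Differentiable ℝ fun z => flatForm z b
      + 1 / 2 * (quadHess σ z z * conj (quadHess σ z b)) :=
    df.add ((differentiable_const _).mul ((dq _ differentiable_id).mul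
      (Complex.conjCLE.differentiable.comp (dq _ (differentiable_const b)))))
  have L0 : HasDerivAt (fun t : ℝ => z + t • v) v 0 := by
    simpa using ((hasDerivAt_id (0 : ℝ)).smul_const v).const_add z
  have affine : ∀ x y : ℂ, HasDerivAt (fun t : ℝ => x + t • y) y 0 := fun x y => by
    simpa using ((hasDerivAt_id (0 : ℝ)).smul_const y).const_add x
  have h1 := MetricData.hasDerivAt_comp_line hd z v 0
  have hf : HasDerivAt (fun t : ℝ => flatForm (z + t • v) b) (flatForm v b) 0 := by
    simpa using affine (flatForm z b) (flatForm v b)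
  have hq : HasDerivAt (fun t : ℝ => conj (quadHess σ (z + t • v) b))
      (conj (quadHess σ v b)) 0 := by
    simpa using affine (conj (quadHess σ z b)) (conj (quadHess σ v b))
  have hs := MetricData.hasDerivAt_bilin (metricData σ).S L0 L0
  have h2 := hf.add ((hs.mul hq).const_mul (1 / 2))
  have h3 := h1.unique h2
  simp only [zero_smul, add_zero, metricData_S] at h3
  rw [e, h3, quadHess_symm σ v z]
  ring

theorem hCoeff_eq (A B : Fin 4 × Fin n) (z : Coord n) : hCoeff σ A B z
    = flatForm (Pi.single A 1) (Pi.single B 1)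
      + quadHess σ z (Pi.single A 1) * conj (quadHess σ z (Pi.single B 1)) := by
  have hI : (Pi.single A Complex.I : Coord n) = Complex.I • Pi.single A 1 := by
    rw [← Pi.single_smul, smul_eq_mul, mul_one]
  rw [hCoeff, dz, fderiv_dzbar_potential, fderiv_dzbar_potential, hI]
  simp only [map_smul, LinearMap.smul_apply, smul_eq_mul, map_mul, Complex.conj_I]
  -- `∂/∂z^A` keeps the complex-linear terms and kills the last one, antilinear in the direction.
  linear_combination (-1 / 2) * (flatForm (Pi.single A 1) (Pi.single B 1)
    + quadHess σ z (Pi.single A 1) * conj (quadHess σ z (Pi.single B 1))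
    - 1 / 2 * (quadHess σ z z * conj (quadHess σ (Pi.single A 1) (Pi.single B 1))))
    * Complex.I_sq

theorem coord_eq_sum (v : Coord n) : v = ∑ A, v A • (Pi.single A 1 : Coord n) := by
  funext B
  simp [Finset.sum_apply, Pi.single_apply]

/-- Bridge from the Wirtinger definition to the abstract model, obtained by expanding both vectors
in the standard basis. -/
theorem metric_eq : metric σ = (metricData σ).g := by
  funext z v w
  have hH : flatForm v w = ∑ A, ∑ B,
      flatForm (Pi.single A 1 : Coord n) (Pi.single B 1) * v A * conj (w B) := by
    conv_lhs => rw [coord_eq_sum v, coord_eq_sum w]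
    simp only [map_sum, LinearMap.sum_apply, map_smul, map_smulₛₗ, LinearMap.smul_apply,
      smul_eq_mul, Finset.mul_sum]
    rw [Finset.sum_comm]
    exact Finset.sum_congr rfl fun A _ => Finset.sum_congr rfl fun B _ => by ring
  have hS : ∀ v, quadHess σ z v = ∑ A, v A * quadHess σ z (Pi.single A 1) := fun v => by
    conv_lhs => rw [coord_eq_sum v]
    simp
  have hSS : quadHess σ z v * conj (quadHess σ z w) = ∑ A, ∑ B,
      quadHess σ z (Pi.single A 1) * conj (quadHess σ z (Pi.single B 1)) * v A * conj (w B) := by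
    rw [hS v, hS w, map_sum, Finset.sum_mul_sum]
    refine Finset.sum_congr rfl fun A _ => Finset.sum_congr rfl fun B _ => ?_
    rw [map_mul]
    ring
  have hg : (metricData σ).g z v w
      = (flatForm v w + quadHess σ z v * conj (quadHess σ z w)).re := by
    rw [MetricData.g, metricData_G, metricData_S, metricData_S, Complex.inner, Complex.add_re]
    simp
    ring
  rw [hg, hH, hSS, metric, ← Finset.sum_add_distrib]
  simp only [← Finset.sum_add_distrib, hCoeff_eq, add_mul]

end ConfGroup

/-! ### Homotheties and the semidirect product -/

namespace ConfGroup

variable {n : ℕ} (σ : Matrix (Fin n) (Fin n) ℂ)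

/-- The flat form pairs only the first `2n` coordinates with the last `2n`, so each half of a vector
is null. -/
theorem span_null_eq_top : Submodule.span ℝ {v | (metricData σ).G v v = 0} = ⊤ := by
  rw [eq_top_iff]
  intro v _
  let x : Coord n := fun A => ![v (0, A.2), v (1, A.2), 0, 0] A.1
  let y : Coord n := fun A => ![0, 0, v (2, A.2), v (3, A.2)] A.1
  have hv : v = x + y := by
    funext ⟨k, i⟩
    fin_cases k <;> simp [x, y]
  rw [hv]
  refine Submodule.add_mem _ (Submodule.subset_span ?_) (Submodule.subset_span ?_) <;>
  · change (flatForm _ _).re = 0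
    rw [flatForm_apply, sum_coord]
    simp [x, y]

theorem two_lt_finrank (hn : 1 ≤ n) : 2 < Module.finrank ℝ (Coord n) := by
  rw [Module.finrank_pi_fintype]
  simp
  omega

theorem phi_apply (a b : ℝ) (z : Coord n) (A : Fin 4 × Fin n) :
    phi n a b z A = (Real.exp (weight a b A.1) : ℂ) * z A := rfl

theorem phi_zero (a b : ℝ) : phi n a b 0 = 0 := (diagMap a b).map_zero

theorem phi_mul (a b a' b' : ℝ) : phi n a b * phi n a' b' = phi n (a + a') (b + b') := by
  refine Equiv.ext fun z => funext fun A => ?_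
  rw [Equiv.Perm.mul_apply, phi_apply, phi_apply, phi_apply, ← mul_assoc, ← Complex.ofReal_mul,
    ← Real.exp_add]
  congr 3
  obtain ⟨k, i⟩ := A
  fin_cases k <;> simp [weight] <;> ring

theorem phi_zero_zero : phi n 0 0 = 1 := by
  refine Equiv.ext fun z => funext fun A => ?_
  obtain ⟨k, i⟩ := A
  fin_cases k <;> simp [phi_apply, weight]

theorem phi_inv (a b : ℝ) : (phi n a b)⁻¹ = phi n (-a) (-b) := by
  rw [inv_eq_iff_mul_eq_one, phi_mul, add_neg_cancel, add_neg_cancel, phi_zero_zero]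

theorem fderiv_phi (a b : ℝ) (z v : Coord n) : fderiv ℝ (phi n a b) z v = phi n a b v := by
  let T : Coord n →L[ℝ] Coord n :=
    ((diagMap a b : Coord n ≃ₗ[ℂ] Coord n).toLinearMap.restrictScalars ℝ).toContinuousLinearMap
  change fderiv ℝ T z v = T v
  rw [T.fderiv]

theorem contDiff_phi (a b : ℝ) : ContDiff ℝ ∞ (phi n a b) :=
  ((diagMap a b : Coord n ≃ₗ[ℂ] Coord n).toLinearMap.restrictScalars ℝ).toContinuousLinearMap.contDiff

theorem isDiffeo_phi (a b : ℝ) : IsDiffeo (phi n a b) := by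
  refine ⟨contDiff_phi a b, ?_⟩
  rw [← Equiv.Perm.inv_def, phi_inv]
  exact contDiff_phi _ _

theorem isHomothety_phi (a b : ℝ) : IsHomothety (metric σ) (phi n a b) (a + b) := by
  refine ⟨isDiffeo_phi a b, fun x v w => ?_⟩
  have hG : flatForm (phi n a b v) (phi n a b w) = (Real.exp (2 * (a + b)) : ℂ) * flatForm v w := by
    rw [flatForm_apply, flatForm_apply, Finset.mul_sum]
    refine Finset.sum_congr rfl fun A _ => ?_
    -- Paired blocks have weights of constant sum, which is what makes the flat form scale.
    have h : 2 * (a + b) = weight a b A.1 + weight a b (A.1 + 2) := by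
      obtain ⟨k, i⟩ := A
      fin_cases k <;> simp [weight] <;> ring
    rw [phi_apply, phi_apply, map_mul, Complex.conj_ofReal, h, Real.exp_add, Complex.ofReal_mul]
    ring
  have hS : ∀ v, quadHess σ (phi n a b x) (phi n a b v)
      = Real.exp (a + b) • quadHess σ x v := fun v => by
    rw [quadHess_apply, quadHess_apply, Finset.smul_sum]
    refine Finset.sum_congr rfl fun i _ => ?_
    rw [Finset.smul_sum]
    refine Finset.sum_congr rfl fun j _ => ?_
    simp only [phi_apply, weight, Real.exp_add, Complex.real_smul, Complex.ofReal_mul]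
    simp
    ring
  rw [pullback, fderiv_phi, fderiv_phi, metric_eq, MetricData.g, MetricData.g]
  simp only [metricData_S, metricData_G]
  rw [hG, hS, hS, Complex.re_ofReal_mul, inner_smul_left, inner_smul_right, two_mul (a + b),
    Real.exp_add]
  simp
  ring

theorem phi_injective (hn : 1 ≤ n) :
    Function.Injective (fun p : ℝ × ℝ => phi n p.1 p.2) := by
  rintro ⟨a, b⟩ ⟨a', b'⟩ h
  have key : ∀ k, weight a b k = weight a' b' k := fun k => by
    have := congrFun (congrArg (fun e : Equiv.Perm (Coord n) => e fun _ => 1) h) (k, ⟨0, hn⟩)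
    simp only [phi_apply, mul_one] at this
    exact Real.exp_injective (by exact_mod_cast this)
  exact Prod.ext (key 0) (key 1)

theorem isHomothety_of_isConformal (hn : 1 ≤ n) {φ : Equiv.Perm (Coord n)}
    (h : IsConformal (metric σ) φ) : ∃ c, IsHomothety (metric σ) φ c := by
  obtain ⟨hφ, u, hu, h⟩ := h
  refine ⟨u 0, hφ, fun x v w => ?_⟩
  rw [h]
  rw [metric_eq] at h
  rw [(metricData σ).conformal_factor_const (two_lt_finrank hn) (span_null_eq_top σ) hφ.1 hu h x]

section Homothety

variable {E : Type*} [NormedAddCommGroup E] [NormedSpace ℝ E] {g : E → E → E → ℝ}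
  {φ ψ : Equiv.Perm E} {c d : ℝ}

theorem IsHomothety.mul (hφ : IsHomothety g φ c) (hψ : IsHomothety g ψ d) :
    IsHomothety g (φ * ψ) (c + d) := by
  refine ⟨hφ.1.mul hψ.1, fun x v w => ?_⟩
  have := hψ.2 x v w
  rw [pullback] at this
  rw [pullback_mul g hφ.1 hψ.1, hφ.2, this, mul_add, Real.exp_add, mul_assoc]

theorem isHomothety_zero_iff : IsHomothety g φ 0 ↔ IsIsometry g φ := by
  refine and_congr_right fun _ => ⟨fun h => ?_, fun h x v w => ?_⟩
  · funext x v w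
    simpa using h x v w
  · simp [h]

theorem IsHomothety.isConformal (h : IsHomothety g φ c) : IsConformal g φ :=
  ⟨h.1, fun _ => c, contDiff_const, h.2⟩

end Homothety

/-- At the origin `g` is the nondegenerate form `G`, so some nonzero value fixes the scale. -/
theorem IsHomothety.unique (hn : 1 ≤ n) {φ : Equiv.Perm (Coord n)} {c d : ℝ}
    (hc : IsHomothety (metric σ) φ c) (hd : IsHomothety (metric σ) φ d) : c = d := by
  have : Nontrivial (Coord n) := Module.nontrivial_of_finrank_pos (R := ℝ)
    ((Nat.zero_lt_two).trans (two_lt_finrank hn))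
  obtain ⟨v, hv⟩ := exists_ne (0 : Coord n)
  have : ∃ w, (metricData σ).G v w ≠ 0 := by
    by_contra! h
    exact hv ((metricData σ).G_nondeg v h)
  obtain ⟨w, hw⟩ := this
  have e := (hc.2 0 v w).symm.trans (hd.2 0 v w)
  rw [metric_eq] at e
  have h0 : (metricData σ).g 0 v w ≠ 0 := by simpa [MetricData.g] using hw
  have := Real.exp_injective (mul_right_cancel₀ h0 e)
  linarith

/-- The one-parameter group `s ↦ φ_{s,s}` of bijections. -/
def phiHom (n : ℕ) : Multiplicative ℝ →* Equiv.Perm (Coord n) where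
  toFun s := phi n s.toAdd s.toAdd
  map_one' := phi_zero_zero
  map_mul' _ _ := (phi_mul _ _ _ _).symm

theorem phiHom_conj_mem (s : Multiplicative ℝ) {f : Equiv.Perm (Coord n)}
    (hf : f ∈ isometryGroup (metric σ)) :
    phiHom n s * f * (phiHom n s)⁻¹ ∈ isometryGroup (metric σ) := by
  change IsIsometry _ _
  rw [← isHomothety_zero_iff]
  have h : IsHomothety (metric σ) f 0 := isHomothety_zero_iff.2 hf
  have h1 : IsHomothety (metric σ) (phiHom n s) _ := isHomothety_phi σ s.toAdd s.toAdd
  have h2 : IsHomothety (metric σ) (phiHom n s)⁻¹ (-s.toAdd + -s.toAdd) := by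
    rw [← map_inv]
    exact isHomothety_phi σ (-s.toAdd) (-s.toAdd)
  convert (h1.mul h).mul h2 using 1
  ring

/-- The action of `ℝ` on the isometry group by conjugation with `φ_{s,s}`. -/
def phiAction : Multiplicative ℝ →* MulAut (isometryGroup (metric σ)) where
  toFun s :=
    { toFun := fun f => ⟨phiHom n s * f * (phiHom n s)⁻¹, phiHom_conj_mem σ s f.2⟩
      invFun := fun f => ⟨phiHom n s⁻¹ * f * (phiHom n s⁻¹)⁻¹, phiHom_conj_mem σ s⁻¹ f.2⟩
      left_inv := fun f => Subtype.ext (by simp [mul_assoc])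
      right_inv := fun f => Subtype.ext (by simp [mul_assoc])
      map_mul' := fun f f' => Subtype.ext (by simp [mul_assoc]) }
  map_one' := by
    ext1 f
    exact Subtype.ext (by simp)
  map_mul' s t := by
    ext1 f
    exact Subtype.ext (by simp [mul_assoc])

theorem isometryGroup_le_conformalGroup :
    isometryGroup (metric σ) ≤ conformalGroup (metric σ) := fun _ hf =>
  (isHomothety_zero_iff.2 hf).isConformal

/-- The homomorphism `(f, s) ↦ f ∘ φ_{s,s}` from the semidirect product to the conformal group. -/
def semidirectHom : isometryGroup (metric σ) ⋊[phiAction σ] Multiplicative ℝ →*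
    conformalGroup (metric σ) :=
  SemidirectProduct.lift (Subgroup.inclusion (isometryGroup_le_conformalGroup σ))
    ((phiHom n).codRestrict (conformalGroup (metric σ))
      fun s => (isHomothety_phi σ s.toAdd s.toAdd).isConformal)
    fun _ => MonoidHom.ext fun _ => rfl

theorem coe_semidirectHom (x : isometryGroup (metric σ) ⋊[phiAction σ] Multiplicative ℝ) :
    (semidirectHom σ x : Equiv.Perm (Coord n))
      = (x.left : Equiv.Perm (Coord n)) * phi n x.right.toAdd x.right.toAdd := rfl

theorem semidirectHom_bijective (hn : 1 ≤ n) : Function.Bijective (semidirectHom σ) := by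
  refine ⟨(injective_iff_map_eq_one _).2 fun x hx => ?_, fun ⟨ψ, hψ⟩ => ?_⟩
  · have h : (x.left : Equiv.Perm (Coord n)) * phi n x.right.toAdd x.right.toAdd = 1 := by
      rw [← coe_semidirectHom, hx, Subgroup.coe_one]
    have h1 : IsHomothety (metric σ) (1 : Equiv.Perm (Coord n))
        (0 + (x.right.toAdd + x.right.toAdd)) := by
      rw [← h]
      exact (isHomothety_zero_iff.2 x.left.2).mul (isHomothety_phi σ _ _)
    have h0 := h1.unique σ hn (isHomothety_zero_iff.2 (isometryGroup (metric σ)).one_mem)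
    have hr : x.right.toAdd = 0 := by linarith
    rw [hr, phi_zero_zero, mul_one] at h
    exact SemidirectProduct.ext (Subtype.ext h) (Multiplicative.toAdd.injective hr)
  · obtain ⟨c, hc⟩ := isHomothety_of_isConformal σ hn hψ
    -- Since `φ_{s,s}` has constant `2s`, the choice `s = c / 2` absorbs the constant `c` of `ψ`.
    have hi : IsHomothety (metric σ) (ψ * phi n (-(c / 2)) (-(c / 2))) 0 := by
      convert hc.mul (isHomothety_phi σ (-(c / 2)) (-(c / 2))) using 1
      ring
    refine ⟨⟨⟨_, isHomothety_zero_iff.1 hi⟩, Multiplicative.ofAdd (c / 2)⟩, Subtype.ext ?_⟩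
    rw [coe_semidirectHom]
    simp [mul_assoc, phi_mul, phi_zero_zero]

end ConfGroup

end

theorem proposition2p4 (n : ℕ) (hn : 1 ≤ n) (σ : Matrix (Fin n) (Fin n) ℂ) (hσ : σ.IsSymm) :
    -- the conformal group is the semidirect product of the isometry group and
    -- the one-parameter group `s ↦ φ_{s,s}`, acting by composition
    (∃ (θ : Multiplicative ℝ →* MulAut (ConfGroup.isometryGroup (ConfGroup.metric σ)))
        (e : SemidirectProduct (ConfGroup.isometryGroup (ConfGroup.metric σ))
              (Multiplicative ℝ) θ ≃*
            ConfGroup.conformalGroup (ConfGroup.metric σ)),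
        ∀ (f : ConfGroup.isometryGroup (ConfGroup.metric σ)) (s : ℝ),
          ((e ⟨f, Multiplicative.ofAdd s⟩ : ConfGroup.conformalGroup (ConfGroup.metric σ)) :
              Equiv.Perm (ConfGroup.Coord n))
            = (f : Equiv.Perm (ConfGroup.Coord n)) * ConfGroup.phi n s s) ∧
    -- this one-parameter group consists of homotheties, proper for `s ≠ 0`
    (∀ s : ℝ, ConfGroup.IsHomothety (ConfGroup.metric σ) (ConfGroup.phi n s s) (2 * s)) ∧
    -- the maps `φ_{a,b}` are homotheties with `φ_{a,b}^* g = e^{2(a+b)} g` fixing the origin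
    (∀ a b : ℝ,
      ConfGroup.IsHomothety (ConfGroup.metric σ) (ConfGroup.phi n a b) (a + b) ∧
        ConfGroup.phi n a b 0 = 0) ∧
    -- they form an abelian group with two independent real parameters
    (∀ a b a' b' : ℝ,
      ConfGroup.phi n a b * ConfGroup.phi n a' b' = ConfGroup.phi n (a + a') (b + b')) ∧
    Function.Injective (fun p : ℝ × ℝ => ConfGroup.phi n p.1 p.2) := by
  refine ⟨⟨ConfGroup.phiAction σ, MulEquiv.ofBijective (ConfGroup.semidirectHom σ)
      (ConfGroup.semidirectHom_bijective σ hn), fun f s => rfl⟩, fun s => ?_,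
    fun a b => ⟨ConfGroup.isHomothety_phi σ a b, ConfGroup.phi_zero a b⟩,
    ConfGroup.phi_mul, ConfGroup.phi_injective hn⟩
  rw [two_mul]
  exact ConfGroup.isHomothety_phi σ s s
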